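/- Let $\mathbf k$ be a field of characteristic zero and $\mathcal O$ the set of planar rooted trees. For trees $\tau,\omega$ let $\tau\rhd\omega=\sum_{s}\tau\circ_s\omega$, summed over the nodes $s$ of $\omega$, where $\tau\circ_s\omega$ is obtained by attaching the root of $\tau$ to $s$ from the left; extend bilinearly to the span $\mathbf k\{\mathcal O\}$. Let $\mathbf k\langle\mathcal O\rangle$ be the free associative algebra on $\mathcal O$ (planar forests with concatenation $\cdot$), with counit $\varepsilon$ and the coshuffle coproduct $\Delta$, the algebra homomorphism for which trees are primitive. Extend $\rhd$ to $\mathbf k\langle\mathcal O\rangle$ by $1\rhd a=a$ and $$(x x_1\cdots x_n)\rhd a=x\rhd\big((x_1\cdots x_n)\rhd a\big)-\sum_{i=1}^n\big(x_1\cdots(x\rhd x_i)\cdots x_n\big)\rhd a$$ for $x,x_i,a\in\mathbf k\{\mathcal O\}$, and by $X\rhd 1=\varepsilon(X)1$ and $X\rhd(a_1\cdots a_m)=\sum (X_{(1)}\rhd a_1)\cdots(X_{(m)}\rhd a_m)$ for $X\in \mathbf k\langle\mathcal O\rangle$, $a_i\in\mathbf k\{\mathcal O\}$. Let $(\mathbf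 k\langle\langle\mathcal O\rangle\rangle,\cdot,\Delta,\rhd)$ be the completion with respect to the filtration by the number of nodes (a complete post-Hopf algebra, whose elements are the Lie--Butcher series), and let $G=\{a\in\mathbf k\langle\langle\mathcal O\rangle\rangle : \Delta(a)=a\otimes a,\ \varepsilon(a)=1\}$ be its set of group-like elements. A post-group is a group $(G,\cdot)$ with a multiplication $\rhd$ such that each $b\mapsto a\rhd b$ is an automorphism of $(G,\cdot)$ and $(a\cdot(a\rhd b))\rhd c=a\rhd(b\rhd c)$ for all $a,b,c$; its sub-adjacent group is the set $G$ with the product $a\circ b=a\cdot(a\rhd b)$. The sub-adjacent complete Hopf algebra of $\mathbf k\langle\langle\mathcal O\rangle\rangle$ has the product $a*_\rhd b=\sum a_{(1)}\cdot(a_{(2)}\rhd b)$ and the same unit, coproduct and counit. Theorem. The set $G$, with the restrictions of $\cdot$ and $\rhd$ and with unit $1$, is a post-group. The group-like elements of the sub-adjacent complete Hopf algebra $(\mathbf k\langle\langle\mathcal O\rangle\rangle,*_\rhd,\Delta)$ form a group under $*_\rhd$ with unit $1$, the Lie--Butcher group $G_{\mathrm{LB}}$, and the sub-adjacent group of the post-group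 $(G,\cdot,\rhd)$ is equal to $G_{\mathrm{LB}}$. -/

import Mathlib

open scoped TensorProduct

/-- A post-group: a group `G` with a second multiplication `rhd` such that every left
multiplication `rhd a` is an automorphism of the group `G` and the weighted associativity
`(a * (a ▷ b)) ▷ c = a ▷ (b ▷ c)` holds. -/
structure PostGroup (G : Type*) extends Group G where
  rhd : G → G → G
  rhd_bijective : ∀ a, Function.Bijective (rhd a)
  rhd_mul : ∀ a b c, rhd a (b * c) = rhd a b * rhd a c
  rhd_rhd : ∀ a b c, rhd (a * rhd a b) c = rhd a (rhd b c)

namespace PostGroup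

variable {G : Type*}

theorem rhd_one (P : PostGroup G) (a : G) : P.rhd a P.one = P.one := by
  let := P.toGroup
  have h : P.rhd a (1 * 1) = P.rhd a 1 * P.rhd a 1 := P.rhd_mul a 1 1
  rw [mul_one] at h
  exact left_eq_mul.mp h

theorem circ_assoc (P : PostGroup G) (a b c : G) :
    P.mul (P.mul a (P.rhd a b)) (P.rhd (P.mul a (P.rhd a b)) c)
      = P.mul a (P.rhd a (P.mul b (P.rhd b c))) := by
  let := P.toGroup
  change a * P.rhd a b * P.rhd (a * P.rhd a b) c = a * P.rhd a (b * P.rhd b c)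
  rw [P.rhd_rhd, P.rhd_mul, mul_assoc]

theorem circ_one (P : PostGroup G) (a : G) : P.mul a (P.rhd a P.one) = a := by
  let := P.toGroup
  rw [P.rhd_one]
  exact mul_one a

/-- The inverse of `a` in the sub-adjacent group: the preimage of `a⁻¹` under `b ↦ a ▷ b`. -/
noncomputable def dagger (P : PostGroup G) (a : G) : G :=
  (Equiv.ofBijective (P.rhd a) (P.rhd_bijective a)).symm (P.inv a)

theorem circ_dagger (P : PostGroup G) (a : G) : P.mul a (P.rhd a (P.dagger a)) = P.one := by
  let := P.toGroup
  have h : P.rhd a (P.dagger a) = P.inv a :=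
    (Equiv.ofBijective (P.rhd a) (P.rhd_bijective a)).apply_symm_apply _
  rw [h]
  exact mul_inv_cancel a

/-- The sub-adjacent group of a post-group: the product is `a ∘ b = a * (a ▷ b)`, with the same
unit and with inverse `P.dagger`. -/
noncomputable abbrev subAdjacent (P : PostGroup G) : Group G :=
  let _ : Mul G := ⟨fun a b => P.mul a (P.rhd a b)⟩
  let _ : One G := ⟨P.one⟩
  let _ : Inv G := ⟨P.dagger⟩
  Group.ofRightAxioms P.circ_assoc P.circ_one P.circ_dagger

end PostGroup

namespace LieButcher

/-- Planar rooted trees: a tree is its root together with the ordered list of its branches. -/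
inductive PTree : Type
  | node : List PTree → PTree

/-- Planar forests: words in planar rooted trees; the product is concatenation. -/
abbrev Forest : Type := FreeMonoid PTree

mutual
/-- Number of nodes of a tree. -/
def PTree.size : PTree → ℕ
  | .node ts => sizeList ts + 1
/-- Number of nodes of a list of trees. -/
def sizeList : List PTree → ℕ
  | [] => 0
  | t :: ts => t.size + sizeList ts
end

/-- Number of nodes of a forest. -/
def Forest.size (w : Forest) : ℕ := sizeList w.toList

mutual
/-- The list, with one entry for each node `s` of `ω`, of the trees obtained by attaching the root
of `τ` to `s` from the left. -/
def graftings (τ : PTree) : PTree → List PTree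
  | .node ts => .node (τ :: ts) :: (graftingsList τ ts).map .node
/-- The same for a list of trees: in one of the trees, `τ` is attached to one node. -/
def graftingsList (τ : PTree) : List PTree → List (List PTree)
  | [] => []
  | t :: ts => (graftings τ t).map (· :: ts) ++ (graftingsList τ ts).map (t :: ·)
end

theorem length_of_mem_graftingsList (τ : PTree) :
    ∀ (u v : List PTree), v ∈ graftingsList τ u → v.length = u.length
  | [], v, h => by simp [graftingsList] at h
  | t :: ts, v, h => by
    simp only [graftingsList, List.mem_append, List.mem_map] at h
    rcases h with ⟨t', _, rfl⟩ | ⟨ts', h', rfl⟩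
    · simp
    · simp [length_of_mem_graftingsList τ ts ts' h']

section Algebra

variable (k : Type*) [Field k]

/-- The vector space with basis the planar rooted trees. -/
abbrev TreeSpace : Type _ := PTree →₀ k

/-- The algebra of planar forests: the free associative algebra on the planar rooted trees, that
is, the universal enveloping algebra of the free Lie algebra on `TreeSpace k`. The product is
concatenation of forests. -/
abbrev ForestAlg : Type _ := MonoidAlgebra k Forest

variable {k} in
/-- A forest as an element of the forest algebra. -/
noncomputable abbrev ofForest (w : Forest) : ForestAlg k := MonoidAlgebra.single w 1

/-- The inclusion of the span of the trees in the forest algebra. -/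
noncomputable def treeIncl : TreeSpace k →ₗ[k] ForestAlg k :=
  Finsupp.linearCombination k fun t => ofForest (FreeMonoid.of t)

/-- The linear map on forests with prescribed values on the basis of forests. -/
noncomputable def linExt {M : Type*} [AddCommGroup M] [Module k M] (f : Forest → M) :
    ForestAlg k →ₗ[k] M :=
  Finsupp.linearCombination k f ∘ₗ (MonoidAlgebra.coeffLinearEquiv k).toLinearMap

/-- The counit: the coefficient of the empty forest. -/
noncomputable def counit : ForestAlg k →ₗ[k] k := linExt k fun w => if w.size = 0 then 1 else 0

/-- The coshuffle coproduct: the algebra homomorphism for which every tree is primitive. -/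
noncomputable def coshuffle : ForestAlg k →ₐ[k] ForestAlg k ⊗[k] ForestAlg k :=
  MonoidAlgebra.lift k _ _ (FreeMonoid.lift fun t =>
    ofForest (FreeMonoid.of t) ⊗ₜ 1 + 1 ⊗ₜ ofForest (FreeMonoid.of t))

/-- The left grafting operator `τ ▷ ω`, the sum over all nodes of `ω`, as a linear map in `ω`. -/
noncomputable def leftGraft (τ : PTree) : TreeSpace k →ₗ[k] TreeSpace k :=
  Finsupp.linearCombination k fun ω =>
    ((graftings τ ω).map fun ω' => Finsupp.single ω' (1 : k)).sum

/-- The action of a word of trees on trees, by recursion on its length: `1 ▷ a = a` and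
`(x x₁ ⋯ xₙ) ▷ a = x ▷ ((x₁ ⋯ xₙ) ▷ a) - ∑ᵢ (x₁ ⋯ (x ▷ xᵢ) ⋯ xₙ) ▷ a`. The entries of
`graftingsList x [x₁, …, xₙ]` are the summands of `∑ᵢ x₁ ⋯ (x ▷ xᵢ) ⋯ xₙ`. -/
noncomputable def wordAct : List PTree → TreeSpace k →ₗ[k] TreeSpace k
  | [] => LinearMap.id
  | x :: u => leftGraft k x ∘ₗ wordAct u -
      ((graftingsList x u).attach.map fun v => wordAct v.1).sum
termination_by u => u.length
decreasing_by
  · simp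
  · have := length_of_mem_graftingsList x u v.1 v.2
    simp; omega

/-- `X ↦ X ▷ t` for a tree `t`. -/
noncomputable def actOnTree (t : PTree) : ForestAlg k →ₗ[k] ForestAlg k :=
  linExt k fun u => treeIncl k (wordAct k u.toList (Finsupp.single t 1))

/-- `X ↦ X ▷ (a₁ ⋯ aₘ)` for trees `a₁, …, aₘ`: `X ▷ 1 = ε(X) 1` and
`X ▷ (a₁ ⋯ aₘ) = ∑ (X₍₁₎ ▷ a₁) ⋯ (X₍ₘ₎ ▷ aₘ)`. -/
noncomputable def actOnWord : List PTree → ForestAlg k →ₗ[k] ForestAlg k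
  | [] => (counit k).smulRight 1
  | t :: ts => LinearMap.mul' k (ForestAlg k) ∘ₗ
      TensorProduct.map (actOnTree k t) (actOnWord ts) ∘ₗ (coshuffle k).toLinearMap

/-- The post-Hopf product `X ▷ Y` on the forest algebra. -/
noncomputable def rhd (X Y : ForestAlg k) : ForestAlg k :=
  linExt k (fun w => actOnWord k w.toList X) Y

end Algebra

section Completion

theorem finite_sizeList_le (n : ℕ) : {w : List PTree | sizeList w ≤ n}.Finite := by
  induction n with
  | zero =>
    refine (Set.finite_singleton []).subset fun w hw => ?_
    rcases w with _ | ⟨⟨ts⟩, w⟩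
    · rfl
    · simp [sizeList, PTree.size] at hw
  | succ n ih =>
    refine ((ih.image2 (fun f g => PTree.node f :: g) ih).insert []).subset fun w hw => ?_
    rcases w with _ | ⟨⟨ts⟩, w⟩
    · exact Set.mem_insert _ _
    · simp only [Set.mem_ofPred_eq, sizeList, PTree.size] at hw
      exact Set.mem_insert_of_mem _
        ⟨ts, by simp only [Set.mem_ofPred_eq]; omega, w, by simp only [Set.mem_ofPred_eq]; omega, rfl⟩

/-- The finite set of planar forests with at most `n` nodes. -/
noncomputable def forestsLE (n : ℕ) : Finset Forest :=
  ((finite_sizeList_le n).preimage (FreeMonoid.toList.injective.injOn)).toFinset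

variable (k : Type*) [Field k]

/-- Lie-Butcher series: the completion of the forest algebra with respect to the filtration by
the number of nodes. There are finitely many forests with a given number of nodes, so an element
of the completion is a formal series `∑ a(w) w` over all planar forests, with arbitrary
coefficients `a(w)`. -/
abbrev Series : Type _ := Forest → k

/-- The completed tensor square of the space of Lie-Butcher series: formal series
`∑ T(u, v) u ⊗ v` over pairs of forests. -/
abbrev Series₂ : Type _ := Forest × Forest → k

variable {k}

/-- The part of a series supported on forests with at most `n` nodes; it represents the class of
the series modulo filtration degree `n + 1`. -/
noncomputable def trunc (n : ℕ) (a : Series k) : ForestAlg k :=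
  ∑ w ∈ forestsLE n, MonoidAlgebra.single w (a w)

/-- An element of the forest algebra as a (finite) series. -/
noncomputable def toSeries (X : ForestAlg k) : Series k := fun w => X.coeff w

/-! The operations of the forest algebra preserve the number of nodes. Their continuous
extensions to series are computed, at a coefficient of degree `n`, on truncations at degree `n`. -/

/-- The completed concatenation product. -/
noncomputable def mulS (a b : Series k) : Series k := fun w =>
  (trunc w.size a * trunc w.size b).coeff w

/-- The completed product `▷`. -/
noncomputable def rhdS (a b : Series k) : Series k := fun w =>
  (rhd k (trunc w.size a) (trunc w.size b)).coeff w

/-- The coefficient of `u ⊗ v` in an element of the tensor square of the forest algebra. -/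
noncomputable def coeff₂ (u v : Forest) : ForestAlg k ⊗[k] ForestAlg k →ₗ[k] k :=
  LinearMap.mul' k k ∘ₗ TensorProduct.map
    (Finsupp.lapply u ∘ₗ (MonoidAlgebra.coeffLinearEquiv k).toLinearMap)
    (Finsupp.lapply v ∘ₗ (MonoidAlgebra.coeffLinearEquiv k).toLinearMap)

/-- The completed coshuffle coproduct. -/
noncomputable def comulS (a : Series k) : Series₂ k := fun p =>
  coeff₂ p.1 p.2 (coshuffle k (trunc (p.1.size + p.2.size) a))

/-- The unit series: the empty forest. -/
noncomputable def oneS : Series k := toSeries 1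

/-- The completed counit: the coefficient of the empty forest. -/
noncomputable def counitS (a : Series k) : k := counit k (trunc 0 a)

/-- The completed tensor product of two series. -/
def tensorS (a b : Series k) : Series₂ k := fun p => a p.1 * b p.2

/-- The product of the sub-adjacent complete Hopf algebra, `a * b = ∑ a₍₁₎ · (a₍₂₎ ▷ b)`: with
`Δ a = ∑ T(u, v) u ⊗ v` this is `∑ T(u, v) u · (v ▷ b)`. Only pairs `u`, `v` with at most
as many nodes as `w` contribute to the coefficient of `w`. -/
noncomputable def starS (a b : Series k) : Series k := fun w =>
  ∑ p ∈ forestsLE w.size ×ˢ forestsLE w.size,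
    comulS a p * mulS (toSeries (ofForest p.1)) (rhdS (toSeries (ofForest p.2)) b) w

variable (k)

/-- The set of group-like elements of the complete coalgebra of Lie-Butcher series:
`Δ a = a ⊗ a` and `ε(a) = 1`. The complete post-Hopf algebra `(·, Δ, ▷)` and its sub-adjacent
complete Hopf algebra `(*, Δ)` have the same coproduct and counit, hence the same group-like
elements. -/
def GroupLike : Type _ := {a : Series k // comulS a = tensorS a a ∧ counitS a = 1}

end Completion

end LieButcher

-- Write `x * Y = x·Y + x ▷ Y` for a tree `x` (`starLetter`). The recursion defining the action of
-- words on trees says exactly that `(x * Y) ▷ t = x ▷ (Y ▷ t)` for a tree `t`. A tree is primitive,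
-- so it acts as a derivation and a coderivation, and this identity extends from trees to all
-- forests (`act_starLetter`). Grafting onto a word preserves its length; hence `x·u` differs from
-- `x * u` by words of the length of `u`, and the operators `x *` generate the whole algebra from
-- `1` (`star_induction`). Induction along these generators yields the post-Hopf identities
-- `act_mul`, `coshuffle_act` and `act_act`.
--
-- All operations respect the number of nodes, so each identity passes to series by comparing
-- truncations modulo high order (`eq_of_approx`). On a group-like series the Sweedler sums
-- collapse, and the identities become the post-group axioms.
--
-- Invertibility is a unipotence argument. A group-like `a` is `1` plus terms of positive degree, so
-- `b ↦ a·b` and `b ↦ a ▷ b` are the identity up to higher order, hence bijective on series. The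
-- operators on the tensor square are unipotent too, so the solution `b` is group-like when the
-- right-hand side is. Concatenation and `▷` are handled together through `IsHopfOperation`. Finally
-- `starS_eq` identifies the sub-adjacent product with `a·(a ▷ b)`.

namespace LieButcher

-- Post-Hopf identities on the forest algebra.

section PostHopf

variable {k : Type*} [Field k]

variable (k) in
/-- A word of trees as an element of the forest algebra. -/
noncomputable def word (u : List PTree) : ForestAlg k := ofForest (FreeMonoid.ofList u)

theorem word_nil : word k [] = 1 := rfl

theorem word_append (u v : List PTree) : word k (u ++ v) = word k u * word k v := by
  simp [word, MonoidAlgebra.single_mul_single, FreeMonoid.ofList_append]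

theorem word_cons (t : PTree) (u : List PTree) : word k (t :: u) = word k [t] * word k u :=
  word_append [t] u

theorem linearMap_ext_word {M : Type*} [AddCommGroup M] [Module k M] {f g : ForestAlg k →ₗ[k] M}
    (h : ∀ u, f (word k u) = g (word k u)) : f = g :=
  (MonoidAlgebra.basis Forest k).ext fun w => by
    simpa [word] using h w.toList

theorem linExt_word {M : Type*} [AddCommGroup M] [Module k M] (f : Forest → M) (u : List PTree) :
    linExt k f (word k u) = f (FreeMonoid.ofList u) := by
  change Finsupp.linearCombination k f (Finsupp.single (FreeMonoid.ofList u) 1) = _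
  rw [Finsupp.linearCombination_single, one_smul]

variable (k) in
/-- The post-Hopf product as a bilinear map. -/
noncomputable def act : ForestAlg k →ₗ[k] ForestAlg k →ₗ[k] ForestAlg k :=
  (linExt k fun w => actOnWord k w.toList).flip

theorem rhd_eq_act (X Y : ForestAlg k) : rhd k X Y = act k X Y := by
  have : linExt k (fun w => actOnWord k w.toList X) = act k X := linearMap_ext_word fun u => by
    rw [act, LinearMap.flip_apply, linExt_word, linExt_word]
  exact congr($this Y)

theorem act_word_nil (X : ForestAlg k) : act k X (word k []) = counit k X • 1 := by
  rw [act, LinearMap.flip_apply, linExt_word]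
  simp [actOnWord]

theorem flip_act_word (u : List PTree) : (act k).flip (word k u) = actOnWord k u := by
  rw [act, LinearMap.flip_flip, linExt_word, FreeMonoid.toList_ofList]

theorem act_word_cons (X : ForestAlg k) (t : PTree) (u : List PTree) :
    act k X (word k (t :: u)) = LinearMap.mul' k _
      (TensorProduct.map (actOnTree k t) ((act k).flip (word k u)) (coshuffle k X)) := by
  rw [flip_act_word, ← LinearMap.flip_apply, flip_act_word]
  rfl

theorem coshuffle_letter (x : PTree) :
    coshuffle k (word k [x]) = word k [x] ⊗ₜ 1 + 1 ⊗ₜ word k [x] := by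
  have : FreeMonoid.ofList [x] = FreeMonoid.of x := rfl
  simp [coshuffle, word, this]

theorem coshuffle_one : coshuffle k 1 = 1 ⊗ₜ 1 := by
  rw [map_one, Algebra.TensorProduct.one_def]

theorem counit_word (u : List PTree) : counit k (word k u) = if sizeList u = 0 then 1 else 0 := by
  rw [counit, linExt_word]
  rfl

theorem sizeList_append (u v : List PTree) : sizeList (u ++ v) = sizeList u + sizeList v := by
  induction u with
  | nil => simp [sizeList]
  | cons t u ih => simp [sizeList, ih, add_assoc]

theorem PTree.size_pos (t : PTree) : 0 < t.size := by
  cases t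
  simp [PTree.size]

theorem counit_one : counit k (1 : ForestAlg k) = 1 := by
  rw [← word_nil, counit_word, sizeList, if_pos rfl]

theorem counit_letter_mul (x : PTree) (Y : ForestAlg k) : counit k (word k [x] * Y) = 0 := by
  have : counit k ∘ₗ LinearMap.mulLeft k (word k [x]) = 0 := linearMap_ext_word fun u => by
    have := x.size_pos
    simp only [LinearMap.comp_apply, LinearMap.mulLeft_apply, ← word_cons, counit_word,
      LinearMap.zero_apply]
    exact if_neg (by rw [sizeList]; omega)
  exact congr($this Y)

theorem treeIncl_single (t : PTree) : treeIncl k (Finsupp.single t 1) = word k [t] := by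
  simp [treeIncl, word]

theorem actOnTree_word (t : PTree) (u : List PTree) :
    actOnTree k t (word k u) = treeIncl k (wordAct k u (Finsupp.single t 1)) := by
  rw [actOnTree, linExt_word, FreeMonoid.toList_ofList]

theorem actOnTree_one (t : PTree) : actOnTree k t 1 = word k [t] := by
  rw [← word_nil, actOnTree_word, wordAct, LinearMap.id_apply, treeIncl_single]

theorem wordAct_cons (x : PTree) (u : List PTree) (z : TreeSpace k) :
    wordAct k (x :: u) z = leftGraft k x (wordAct k u z) -
      ((graftingsList x u).map fun v => wordAct k v z).sum := by
  rw [wordAct, LinearMap.sub_apply, LinearMap.comp_apply]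
  congr 1
  rw [List.attach_map_val (f := wordAct k), ← LinearMap.applyₗ_apply_apply, map_list_sum,
    List.map_map]
  rfl

theorem leftGraft_single (x t : PTree) : leftGraft k x (Finsupp.single t 1) =
    ((graftings x t).map fun t' => Finsupp.single t' (1 : k)).sum := by
  simp [leftGraft]

theorem actOnTree_letter (x t : PTree) :
    actOnTree k t (word k [x]) = treeIncl k (leftGraft k x (Finsupp.single t 1)) := by
  rw [actOnTree_word, wordAct_cons]
  simp [graftingsList, wordAct]

theorem act_one : act k 1 = LinearMap.id := by
  refine linearMap_ext_word fun u => ?_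
  induction u with
  | nil => rw [act_word_nil, counit_one, one_smul, word_nil, LinearMap.id_apply]
  | cons t u ih =>
    rw [act_word_cons, coshuffle_one, TensorProduct.map_tmul, LinearMap.mul'_apply,
      LinearMap.flip_apply, ih, actOnTree_one, LinearMap.id_apply, LinearMap.id_apply, word_cons t u]

/-- Primitivity of `x` leaves only two terms in the Sweedler sum; this is the Leibniz rule with a
tree as first factor. -/
theorem act_letter_cons (x t : PTree) (u : List PTree) :
    act k (word k [x]) (word k (t :: u)) =
      treeIncl k (leftGraft k x (Finsupp.single t 1)) * word k u
        + word k [t] * act k (word k [x]) (word k u) := by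
  rw [act_word_cons, coshuffle_letter, map_add, map_add, TensorProduct.map_tmul,
    TensorProduct.map_tmul, LinearMap.mul'_apply, LinearMap.mul'_apply, LinearMap.flip_apply,
    LinearMap.flip_apply, act_one, actOnTree_one, actOnTree_letter, LinearMap.id_apply]

theorem act_letter_nil (x : PTree) : act k (word k [x]) 1 = 0 := by
  rw [← word_nil, act_word_nil, ← mul_one (word k [x]), counit_letter_mul, zero_smul]

theorem act_letter_letter (x t : PTree) :
    act k (word k [x]) (word k [t]) = treeIncl k (leftGraft k x (Finsupp.single t 1)) := by
  rw [act_letter_cons, word_nil, act_letter_nil, mul_zero, add_zero, mul_one]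

/-- A tree acts on the forest algebra by a derivation. -/
theorem act_letter_mul (x : PTree) (Y Z : ForestAlg k) : act k (word k [x]) (Y * Z) =
    act k (word k [x]) Y * Z + Y * act k (word k [x]) Z := by
  have : act k (word k [x]) ∘ₗ (LinearMap.mul k _).flip Z =
      (LinearMap.mul k _).flip Z ∘ₗ act k (word k [x])
        + (LinearMap.mul k _).flip (act k (word k [x]) Z) := by
    refine LinearMap.ext fun Y => ?_
    revert Y Z
    suffices h : ∀ u Z, act k (word k [x]) (word k u * Z) =
        act k (word k [x]) (word k u) * Z + word k u * act k (word k [x]) Z by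
      intro Z
      rw [← LinearMap.ext_iff]
      exact linearMap_ext_word fun u => h u Z
    intro u
    induction u with
    | nil => simp [word_nil, act_letter_nil]
    | cons t u ih =>
      -- The Leibniz rule with first factor a single tree, for arbitrary `Z`; applying it twice
      -- moves the tree `t` past `x` in the induction step.
      have key : ∀ Z, act k (word k [x]) (word k [t] * Z) =
          act k (word k [x]) (word k [t]) * Z + word k [t] * act k (word k [x]) Z := by
        intro Z
        have : act k (word k [x]) ∘ₗ LinearMap.mulLeft k (word k [t]) =
            LinearMap.mulLeft k (act k (word k [x]) (word k [t]))
              + LinearMap.mulLeft k (word k [t]) ∘ₗ act k (word k [x]) :=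
          linearMap_ext_word fun v => by
            simp only [LinearMap.comp_apply, LinearMap.mulLeft_apply, LinearMap.add_apply,
              ← word_cons]
            rw [act_letter_cons, act_letter_letter]
        exact congr($this Z)
      intro Z
      rw [word_cons t u, mul_assoc, key, key, ih]
      noncomm_ring
  exact congr($this Y)

theorem act_letter_treeIncl (x : PTree) (z : TreeSpace k) :
    act k (word k [x]) (treeIncl k z) = treeIncl k (leftGraft k x z) := by
  have : act k (word k [x]) ∘ₗ treeIncl k = treeIncl k ∘ₗ leftGraft k x := by
    refine Finsupp.lhom_ext' fun t => LinearMap.ext_ring ?_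
    simp [treeIncl_single, act_letter_letter]
  exact congr($this z)

/-- Identifies the sum subtracted in the recursion of `wordAct` with the action of `x` on the word
`u`. -/
theorem act_letter_word (x : PTree) (u : List PTree) :
    act k (word k [x]) (word k u) = ((graftingsList x u).map (word k)).sum := by
  induction u with
  | nil => simp [graftingsList, word_nil, act_letter_nil]
  | cons t u ih =>
    rw [act_letter_cons, ih, leftGraft_single, map_list_sum, graftingsList, List.map_append,
      List.sum_append, ← List.sum_map_mul_right, ← List.sum_map_mul_left, List.map_map,
      List.map_map, List.map_map]
    congr 2
    · exact List.map_congr_left fun t' _ => by simp [treeIncl_single, ← word_cons]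
    · exact List.map_congr_left fun v _ => by simp [← word_cons]

/-- Grafting preserves the length of a word, so the empty word could only come from the empty word,
which has no node to graft on. -/
theorem counit_act_letter (x : PTree) (Y : ForestAlg k) :
    counit k (act k (word k [x]) Y) = 0 := by
  have : counit k ∘ₗ act k (word k [x]) = 0 := linearMap_ext_word fun u => by
    rw [LinearMap.comp_apply, act_letter_word, map_list_sum, LinearMap.zero_apply]
    refine List.sum_eq_zero fun c hc => ?_
    simp only [List.map_map, List.mem_map, Function.comp_apply] at hc
    obtain ⟨v, hv, rfl⟩ := hc
    cases v with
    | nil =>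
      have := length_of_mem_graftingsList x u [] hv
      rw [List.length_nil, eq_comm, List.length_eq_zero_iff] at this
      simp [this, graftingsList] at hv
    | cons t v => rw [word_cons, counit_letter_mul]
  exact congr($this Y)

/-- The extension of an endomorphism to the tensor square as a derivation. -/
noncomputable def tensorDer (f : ForestAlg k →ₗ[k] ForestAlg k) :
    ForestAlg k ⊗[k] ForestAlg k →ₗ[k] ForestAlg k ⊗[k] ForestAlg k :=
  TensorProduct.map f LinearMap.id + TensorProduct.map LinearMap.id f

theorem tensorDer_tmul (f : ForestAlg k →ₗ[k] ForestAlg k) (X Y : ForestAlg k) :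
    tensorDer f (X ⊗ₜ Y) = f X ⊗ₜ Y + X ⊗ₜ f Y := rfl

theorem tensorDer_add (f g : ForestAlg k →ₗ[k] ForestAlg k) :
    tensorDer (f + g) = tensorDer f + tensorDer g :=
  TensorProduct.ext' fun X Y => by
    simp only [tensorDer_tmul, LinearMap.add_apply, TensorProduct.add_tmul, TensorProduct.tmul_add]
    abel

theorem tensorDer_mul {f : ForestAlg k →ₗ[k] ForestAlg k}
    (hf : ∀ Y Z, f (Y * Z) = f Y * Z + Y * f Z) (S T : ForestAlg k ⊗[k] ForestAlg k) :
    tensorDer f (S * T) = tensorDer f S * T + S * tensorDer f T := by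
  induction S with
  | zero => simp
  | add S S' h h' => simp only [add_mul, map_add, h, h']; abel
  | tmul A B =>
    induction T with
    | zero => simp
    | add T T' h h' => simp only [mul_add, map_add, h, h']; abel
    | tmul C D =>
      simp only [Algebra.TensorProduct.tmul_mul_tmul, tensorDer_tmul, hf, TensorProduct.add_tmul,
        TensorProduct.tmul_add, add_mul, mul_add]
      abel

theorem coshuffle_treeIncl (z : TreeSpace k) :
    coshuffle k (treeIncl k z) = treeIncl k z ⊗ₜ 1 + 1 ⊗ₜ treeIncl k z := by
  have : (coshuffle k).toLinearMap ∘ₗ treeIncl k =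
      (TensorProduct.mk k _ _).flip 1 ∘ₗ treeIncl k + TensorProduct.mk k _ _ 1 ∘ₗ treeIncl k := by
    refine Finsupp.lhom_ext' fun t => LinearMap.ext_ring ?_
    simp [treeIncl_single, coshuffle_letter]
  exact congr($this z)

/-- The derivation given by a tree is a coderivation. -/
theorem coshuffle_act_letter (x : PTree) (Y : ForestAlg k) :
    coshuffle k (act k (word k [x]) Y) = tensorDer (act k (word k [x])) (coshuffle k Y) := by
  have : (coshuffle k).toLinearMap ∘ₗ act k (word k [x]) =
      tensorDer (act k (word k [x])) ∘ₗ (coshuffle k).toLinearMap := by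
    refine linearMap_ext_word fun u => ?_
    simp only [LinearMap.comp_apply, AlgHom.toLinearMap_apply]
    induction u with
    | nil => simp [word_nil, act_letter_nil, Algebra.TensorProduct.one_def, tensorDer_tmul]
    | cons t u ih =>
      rw [word_cons t u, act_letter_mul, map_add, map_mul, map_mul, map_mul, ih,
        tensorDer_mul (act_letter_mul x), coshuffle_letter, map_add, tensorDer_tmul,
        tensorDer_tmul, act_letter_nil, act_letter_letter, coshuffle_treeIncl,
        TensorProduct.tmul_zero, TensorProduct.zero_tmul, zero_add, add_zero]
  exact congr($this Y)

/-- Left multiplication by a tree for the sub-adjacent product. -/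
noncomputable def starLetter (x : PTree) : ForestAlg k →ₗ[k] ForestAlg k :=
  LinearMap.mulLeft k (word k [x]) + act k (word k [x])

theorem starLetter_apply (x : PTree) (Y : ForestAlg k) :
    starLetter x Y = word k [x] * Y + act k (word k [x]) Y := rfl

/-- Multiplication by `x ⊗ 1 + 1 ⊗ x` is the derivation extension of left multiplication by `x`; the
other summand is a coderivation already. -/
theorem coshuffle_starLetter (x : PTree) (Y : ForestAlg k) :
    coshuffle k (starLetter x Y) = tensorDer (starLetter x) (coshuffle k Y) := by
  rw [starLetter_apply, starLetter, map_add, tensorDer_add, LinearMap.add_apply,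
    coshuffle_act_letter, map_mul, coshuffle_letter]
  congr 1
  generalize coshuffle k Y = T
  induction T with
  | zero => simp
  | add S T hS hT => simp only [mul_add, map_add, hS, hT]
  | tmul A B => simp [add_mul, tensorDer_tmul]

theorem counit_starLetter (x : PTree) (Y : ForestAlg k) : counit k (starLetter x Y) = 0 := by
  rw [starLetter_apply, map_add, counit_letter_mul, counit_act_letter, add_zero]

/-- The defining recursion of `wordAct`, with the subtracted sum moved to the other side. -/
theorem actOnTree_starLetter (x t : PTree) (Y : ForestAlg k) :
    actOnTree k t (starLetter x Y) = act k (word k [x]) (actOnTree k t Y) := by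
  have : actOnTree k t ∘ₗ starLetter x = act k (word k [x]) ∘ₗ actOnTree k t :=
    linearMap_ext_word fun u => by
      rw [LinearMap.comp_apply, LinearMap.comp_apply, starLetter_apply, ← word_cons, map_add,
        actOnTree_word, wordAct_cons, map_sub, act_letter_word, actOnTree_word,
        act_letter_treeIncl, map_list_sum, map_list_sum, List.map_map, List.map_map,
        sub_add_eq_add_sub, sub_eq_iff_eq_add]
      congr 2
      exact List.map_congr_left fun v _ => actOnTree_word t v
  exact congr($this Y)

/-- Induction on the word acted upon: the coproduct of `starLetter x Y` splits by the Leibniz rule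
in the same way as the derivation `x ▷` does on a product. -/
theorem act_starLetter (x : PTree) (Y Z : ForestAlg k) :
    act k (starLetter x Y) Z = act k (word k [x]) (act k Y Z) := by
  suffices h : act k (starLetter x Y) = act k (word k [x]) ∘ₗ act k Y from congr($h Z)
  refine linearMap_ext_word fun u => ?_
  rw [LinearMap.comp_apply]
  induction u generalizing Y with
  | nil =>
    rw [act_word_nil, act_word_nil, counit_starLetter, map_smul, act_letter_nil, smul_zero,
      zero_smul]
  | cons t u ih =>
    rw [act_word_cons, act_word_cons, coshuffle_starLetter]
    generalize coshuffle k Y = T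
    induction T with
    | zero => simp
    | add S T hS hT => simp only [map_add, hS, hT]
    | tmul A B =>
      simp [tensorDer_tmul, act_letter_mul, actOnTree_starLetter, ih]

/-- The forest algebra is generated by the trees under the sub-adjacent product. -/
theorem star_induction {p : ForestAlg k → Prop} (one : p 1)
    (star : ∀ x Y, p Y → p (starLetter x Y)) (add : ∀ X Y, p X → p Y → p (X + Y))
    (smul : ∀ (c : k) X, p X → p (c • X)) (X : ForestAlg k) : p X := by
  let S : Submodule k (ForestAlg k) :=
    { carrier := {X | p X}
      add_mem' := fun {X Y} => add X Y
      zero_mem' := by simpa using smul 0 1 one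
      smul_mem' := fun c X => smul c X }
  -- The induction is on length, not on the word: the correction `x ▷ u` is a sum of words that are
  -- not subwords of `x :: u` but have the length of `u`.
  have h : ∀ n : ℕ, ∀ u : List PTree, u.length = n → word k u ∈ S := by
    intro n
    induction n with
    | zero =>
      intro u hu
      rw [List.length_eq_zero_iff.mp hu]
      exact one
    | succ n ih =>
      intro u hu
      cases u with
      | nil => simp at hu
      | cons x u =>
        rw [List.length_cons, Nat.succ_inj] at hu
        rw [word_cons, ← add_sub_cancel_right (word k [x] * word k u) (act k (word k [x]) (word k u)),
          ← starLetter_apply]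
        refine S.sub_mem (star x _ (ih u hu)) ?_
        rw [act_letter_word]
        refine S.list_sum_mem fun Y hY => ?_
        obtain ⟨v, hv, rfl⟩ := List.mem_map.mp hY
        exact ih v ((length_of_mem_graftingsList x u v hv).trans hu)
  have hS : S.mkQ = 0 := linearMap_ext_word fun u => by
    simpa using h _ u rfl
  exact (Submodule.Quotient.mk_eq_zero S).mp (show S.mkQ X = 0 by rw [hS]; rfl)

/-- The componentwise action of the tensor square of the forest algebra on itself. -/
noncomputable def act₂ : ForestAlg k ⊗[k] ForestAlg k →ₗ[k]
    ForestAlg k ⊗[k] ForestAlg k →ₗ[k] ForestAlg k ⊗[k] ForestAlg k :=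
  TensorProduct.map₂ (act k) (act k)

theorem act₂_tmul (A B C D : ForestAlg k) :
    act₂ (A ⊗ₜ B) (C ⊗ₜ D) = act k A C ⊗ₜ act k B D := rfl

theorem act₂_tensorDer (x : PTree) (S T : ForestAlg k ⊗[k] ForestAlg k) :
    act₂ (tensorDer (starLetter x) S) T = tensorDer (act k (word k [x])) (act₂ S T) := by
  induction S with
  | zero => simp
  | add S S' h h' => simp only [map_add, LinearMap.add_apply, h, h']
  | tmul A B =>
    induction T with
    | zero => simp
    | add T T' h h' => simp only [map_add, h, h']
    | tmul C D =>
      simp [tensorDer_tmul, act₂_tmul, act_starLetter]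

theorem act₂_one (T : ForestAlg k ⊗[k] ForestAlg k) : act₂ (1 ⊗ₜ 1) T = T := by
  induction T with
  | zero => simp
  | add T T' h h' => simp only [map_add, h, h']
  | tmul C D => simp [act₂_tmul, act_one]

/-- `X ▷ (Y Z) = ∑ (X₍₁₎ ▷ Y) (X₍₂₎ ▷ Z)`. -/
theorem act_mul (X : ForestAlg k) (T : ForestAlg k ⊗[k] ForestAlg k) :
    act k X (LinearMap.mul' k _ T) = LinearMap.mul' k _ (act₂ (coshuffle k X) T) := by
  induction X using star_induction with
  | one => rw [coshuffle_one, act₂_one, act_one, LinearMap.id_apply]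
  | add X Y hX hY => simp only [map_add, LinearMap.add_apply, hX, hY]
  | smul c X hX => simp only [map_smul, LinearMap.smul_apply, hX]
  | star x X hX =>
    rw [act_starLetter, hX, coshuffle_starLetter, act₂_tensorDer]
    generalize act₂ (coshuffle k X) T = S
    induction S with
    | zero => simp
    | add S S' h h' => simp only [map_add, h, h']
    | tmul A B => simp [tensorDer_tmul, act_letter_mul]

/-- `Δ (X ▷ Y) = ∑ (X₍₁₎ ▷ Y₍₁₎) ⊗ (X₍₂₎ ▷ Y₍₂₎)`. -/
theorem coshuffle_act (X Y : ForestAlg k) :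
    coshuffle k (act k X Y) = act₂ (coshuffle k X) (coshuffle k Y) := by
  induction X using star_induction with
  | one => rw [coshuffle_one, act₂_one, act_one, LinearMap.id_apply]
  | add X Y hX hY => simp only [map_add, LinearMap.add_apply, hX, hY]
  | smul c X hX => simp only [map_smul, LinearMap.smul_apply, hX]
  | star x X hX =>
    rw [act_starLetter, coshuffle_starLetter, coshuffle_act_letter, hX, act₂_tensorDer]

/-- The map `X₁ ⊗ X₂ ↦ X₁ (X₂ ▷ Y)`. -/
noncomputable def mulAct (Y : ForestAlg k) : ForestAlg k ⊗[k] ForestAlg k →ₗ[k] ForestAlg k :=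
  LinearMap.mul' k _ ∘ₗ TensorProduct.map LinearMap.id ((act k).flip Y)

theorem mulAct_tmul (Y A B : ForestAlg k) : mulAct Y (A ⊗ₜ B) = A * act k B Y := rfl

/-- Associativity `(x * X) * Y = x * (X * Y)` of the sub-adjacent product when the first factor is a
tree. It follows from the Leibniz rule for `x ▷` on `A (B ▷ Y)` and from `act_starLetter`. -/
theorem mulAct_coshuffle_starLetter (x : PTree) (X Y : ForestAlg k) :
    mulAct Y (coshuffle k (starLetter x X)) = starLetter x (mulAct Y (coshuffle k X)) := by
  rw [coshuffle_starLetter]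
  generalize coshuffle k X = T
  induction T with
  | zero => simp
  | add S T hS hT => simp only [map_add, hS, hT]
  | tmul A B =>
    simp only [tensorDer_tmul, map_add, mulAct_tmul, starLetter_apply x, act_letter_mul,
      ← act_starLetter, map_add, add_mul, mul_assoc, LinearMap.add_apply, mul_add]
    abel

/-- `X ▷ (Y ▷ Z) = (∑ X₍₁₎ (X₍₂₎ ▷ Y)) ▷ Z`. -/
theorem act_act (X Y Z : ForestAlg k) :
    act k X (act k Y Z) = act k (mulAct Y (coshuffle k X)) Z := by
  induction X using star_induction with
  | one => rw [coshuffle_one, mulAct_tmul, act_one, one_mul, LinearMap.id_apply, LinearMap.id_apply]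
  | add X Y hX hY => simp only [map_add, LinearMap.add_apply, hX, hY]
  | smul c X hX => simp only [map_smul, LinearMap.smul_apply, hX]
  | star x X hX => rw [act_starLetter, hX, mulAct_coshuffle_starLetter, act_starLetter]

end PostHopf

-- The node filtration and its compatibility with all operations.

section Filtration

mutual
theorem size_of_mem_graftings (τ : PTree) :
    ∀ ω ω' : PTree, ω' ∈ graftings τ ω → ω'.size = τ.size + ω.size
  | .node ts, ω', h => by
    rw [graftings, List.mem_cons, List.mem_map] at h
    rcases h with rfl | ⟨ts', h', rfl⟩
    · simp [PTree.size, sizeList, add_assoc]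
    · simp [PTree.size, sizeList_of_mem_graftingsList τ ts ts' h', add_assoc]
theorem sizeList_of_mem_graftingsList (τ : PTree) :
    ∀ u v : List PTree, v ∈ graftingsList τ u → sizeList v = τ.size + sizeList u
  | [], v, h => by simp [graftingsList] at h
  | t :: ts, v, h => by
    simp only [graftingsList, List.mem_append, List.mem_map] at h
    rcases h with ⟨t', h', rfl⟩ | ⟨ts', h', rfl⟩
    · simp [sizeList, size_of_mem_graftings τ t t' h', add_assoc]
    · simp [sizeList, sizeList_of_mem_graftingsList τ ts ts' h']
      omega
end

variable {k : Type*} [Field k]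

variable (k) in
/-- The filtration of the forest algebra by the number of nodes. -/
noncomputable def filt (n : ℕ) : Submodule k (ForestAlg k) :=
  Submodule.span k (word k '' {u | n ≤ sizeList u})

variable (k) in
/-- The filtration of the tensor square of the forest algebra by the number of nodes. -/
noncomputable def filt₂ (n : ℕ) : Submodule k (ForestAlg k ⊗[k] ForestAlg k) :=
  Submodule.span k ((fun p : List PTree × List PTree => word k p.1 ⊗ₜ[k] word k p.2) ''
    {p | n ≤ sizeList p.1 + sizeList p.2})

theorem word_mem_filt {n : ℕ} {u : List PTree} (h : n ≤ sizeList u) : word k u ∈ filt k n :=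
  Submodule.subset_span ⟨u, h, rfl⟩

theorem word_tmul_word_mem_filt₂ {n : ℕ} {u v : List PTree} (h : n ≤ sizeList u + sizeList v) :
    word k u ⊗ₜ word k v ∈ filt₂ k n :=
  Submodule.subset_span ⟨(u, v), h, rfl⟩

theorem filt_antitone : Antitone (filt k) := fun _ _ h =>
  Submodule.span_mono (Set.image_mono fun _ hu => le_trans h hu)

theorem filt₂_antitone : Antitone (filt₂ k) := fun _ _ h =>
  Submodule.span_mono (Set.image_mono fun _ hu => le_trans h hu)

/-- The span form serves to check that operations are filtered; this coefficient form serves to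
compare with series. -/
theorem mem_filt_iff {n : ℕ} {X : ForestAlg k} :
    X ∈ filt k n ↔ ∀ w : Forest, w.size < n → X.coeff w = 0 := by
  have h : filt k n = Submodule.span k (MonoidAlgebra.basis Forest k '' {w | n ≤ w.size}) := rfl
  rw [h, Module.Basis.mem_span_image]
  constructor
  · intro h w hw
    by_contra hne
    exact absurd (h (Finsupp.mem_support_iff.mpr hne)) (not_le.mpr hw)
  · intro h w hw
    by_contra hlt
    exact Finsupp.mem_support_iff.mp hw (h w (not_le.mp hlt))

theorem coeff₂_tmul (u v : Forest) (X Y : ForestAlg k) :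
    coeff₂ u v (X ⊗ₜ Y) = X.coeff u * Y.coeff v := rfl

theorem mem_filt₂_iff {n : ℕ} {T : ForestAlg k ⊗[k] ForestAlg k} :
    T ∈ filt₂ k n ↔ ∀ u v : Forest, u.size + v.size < n → coeff₂ u v T = 0 := by
  let b := (MonoidAlgebra.basis Forest k).tensorProduct (MonoidAlgebra.basis Forest k)
  have hb : ∀ u v, b.repr T (u, v) = coeff₂ u v T := fun u v => by
    induction T with
    | zero => simp
    | add S T hS hT => simp only [map_add, Finsupp.add_apply, hS, hT]
    | tmul X Y =>
      rw [coeff₂_tmul, mul_comm]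
      exact Module.Basis.tensorProduct_repr_tmul_apply _ _ X Y u v
  have h : filt₂ k n = Submodule.span k (b '' {p | n ≤ p.1.size + p.2.size}) := by
    rw [filt₂]
    congr 1
    refine Set.image_congr fun p _ => ?_
    exact (Module.Basis.tensorProduct_apply' (MonoidAlgebra.basis Forest k)
      (MonoidAlgebra.basis Forest k) p).symm
  rw [h, Module.Basis.mem_span_image]
  constructor
  · intro h u v hw
    by_contra hne
    rw [← hb] at hne
    exact absurd (h (Finsupp.mem_support_iff.mpr hne)) (not_le.mpr hw)
  · rintro h ⟨u, v⟩ hw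
    by_contra hlt
    exact Finsupp.mem_support_iff.mp hw ((hb u v).trans (h u v (not_le.mp hlt)))

theorem filt_zero : filt k 0 = ⊤ :=
  eq_top_iff.mpr fun _ _ => mem_filt_iff.mpr fun _ h => absurd h (Nat.not_lt_zero _)

theorem filt₂_zero : filt₂ k 0 = ⊤ :=
  eq_top_iff.mpr fun _ _ => mem_filt₂_iff.mpr fun _ _ h => absurd h (Nat.not_lt_zero _)

theorem mem_filt_zero (X : ForestAlg k) : X ∈ filt k 0 := filt_zero (k := k) ▸ Submodule.mem_top

theorem mem_filt₂_zero (T : ForestAlg k ⊗[k] ForestAlg k) : T ∈ filt₂ k 0 :=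
  filt₂_zero (k := k) ▸ Submodule.mem_top

theorem bilin_mem_filt (B : ForestAlg k →ₗ[k] ForestAlg k →ₗ[k] ForestAlg k)
    (h : ∀ u v, B (word k u) (word k v) ∈ filt k (sizeList u + sizeList v))
    {m n : ℕ} {X Y : ForestAlg k} (hX : X ∈ filt k m) (hY : Y ∈ filt k n) :
    B X Y ∈ filt k (m + n) := by
  refine LinearMap.BilinMap.apply_apply_mem_of_mem_span _ _ _ B ?_ X Y hX hY
  rintro _ ⟨u, hu, rfl⟩ _ ⟨v, hv, rfl⟩
  exact filt_antitone (add_le_add hu hv) (h u v)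

theorem tmul_mem_filt₂ {m n : ℕ} {X Y : ForestAlg k} (hX : X ∈ filt k m) (hY : Y ∈ filt k n) :
    X ⊗ₜ Y ∈ filt₂ k (m + n) := by
  refine LinearMap.BilinMap.apply_apply_mem_of_mem_span _ _ _ (TensorProduct.mk k _ _) ?_ X Y hX hY
  rintro _ ⟨u, hu, rfl⟩ _ ⟨v, hv, rfl⟩
  exact word_tmul_word_mem_filt₂ (add_le_add hu hv)

theorem mul_mem_filt {m n : ℕ} {X Y : ForestAlg k} (hX : X ∈ filt k m) (hY : Y ∈ filt k n) :
    X * Y ∈ filt k (m + n) :=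
  bilin_mem_filt (LinearMap.mul k _) (fun u v => by
    rw [LinearMap.mul_apply', ← word_append]
    exact word_mem_filt (sizeList_append u v).ge) hX hY

theorem act_letter_mem_filt (x : PTree) {n : ℕ} {Y : ForestAlg k} (hY : Y ∈ filt k n) :
    act k (word k [x]) Y ∈ filt k (x.size + n) := by
  have : filt k n ≤ (filt k (x.size + n)).comap (act k (word k [x])) := by
    refine Submodule.span_le.mpr ?_
    rintro _ ⟨u, hu, rfl⟩
    rw [SetLike.mem_coe, Submodule.mem_comap, act_letter_word]
    refine list_sum_mem fun Z hZ => ?_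
    obtain ⟨v, hv, rfl⟩ := List.mem_map.mp hZ
    refine word_mem_filt ?_
    rw [sizeList_of_mem_graftingsList x u v hv]
    exact Nat.add_le_add_left hu _
  exact this hY

/-- Induction on length through `x·u = x * u - x ▷ u`, as in `star_induction`; the correction words
have exactly the node count of `x :: u`. -/
theorem act_word_mem_filt (l : ℕ) (u : List PTree) (hl : u.length = l) {n : ℕ} {Y : ForestAlg k}
    (hY : Y ∈ filt k n) : act k (word k u) Y ∈ filt k (sizeList u + n) := by
  induction l generalizing u Y n with
  | zero =>
    rw [List.length_eq_zero_iff.mp hl, word_nil, act_one, sizeList, zero_add]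
    exact hY
  | succ l ih =>
    cases u with
    | nil => simp at hl
    | cons x u =>
      rw [List.length_cons, Nat.succ_inj] at hl
      rw [word_cons x u,
        ← add_sub_cancel_right (word k [x] * word k u) (act k (word k [x]) (word k u)),
        ← starLetter_apply, map_sub, LinearMap.sub_apply, act_starLetter, sizeList, add_assoc]
      refine Submodule.sub_mem _ (act_letter_mem_filt x (ih u hl hY)) ?_
      rw [act_letter_word, map_list_sum, ← LinearMap.applyₗ_apply_apply, map_list_sum]
      refine list_sum_mem fun Z hZ => ?_
      simp only [List.map_map, List.mem_map, Function.comp_apply] at hZ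
      obtain ⟨v, hv, rfl⟩ := hZ
      rw [LinearMap.applyₗ_apply_apply, ← add_assoc, ← sizeList_of_mem_graftingsList x u v hv]
      exact ih v ((length_of_mem_graftingsList x u v hv).trans hl) hY

theorem act_mem_filt {m n : ℕ} {X Y : ForestAlg k} (hX : X ∈ filt k m) (hY : Y ∈ filt k n) :
    act k X Y ∈ filt k (m + n) :=
  bilin_mem_filt (act k) (fun u _ => act_word_mem_filt _ u rfl (word_mem_filt le_rfl)) hX hY

theorem bilin_mem_filt₂ {B : ForestAlg k →ₗ[k] ForestAlg k →ₗ[k] ForestAlg k}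
    {B₂ : ForestAlg k ⊗[k] ForestAlg k →ₗ[k] ForestAlg k ⊗[k] ForestAlg k →ₗ[k]
      ForestAlg k ⊗[k] ForestAlg k}
    (hB : ∀ {m n : ℕ} {X Y : ForestAlg k}, X ∈ filt k m → Y ∈ filt k n → B X Y ∈ filt k (m + n))
    (hB₂ : ∀ A A' C C', B₂ (A ⊗ₜ A') (C ⊗ₜ C') = B A C ⊗ₜ B A' C')
    {m n : ℕ} {S T : ForestAlg k ⊗[k] ForestAlg k} (hS : S ∈ filt₂ k m) (hT : T ∈ filt₂ k n) :
    B₂ S T ∈ filt₂ k (m + n) := by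
  refine LinearMap.BilinMap.apply_apply_mem_of_mem_span _ _ _ B₂ ?_ S T hS hT
  rintro _ ⟨p, hp, rfl⟩ _ ⟨q, hq, rfl⟩
  rw [hB₂]
  refine filt₂_antitone ?_ (tmul_mem_filt₂
    (hB (word_mem_filt (u := p.1) le_rfl) (word_mem_filt (u := q.1) le_rfl))
    (hB (word_mem_filt (u := p.2) le_rfl) (word_mem_filt (u := q.2) le_rfl)))
  simp only [Set.mem_ofPred_eq] at hp hq
  omega

theorem mul_mem_filt₂ {m n : ℕ} {S T : ForestAlg k ⊗[k] ForestAlg k} (hS : S ∈ filt₂ k m)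
    (hT : T ∈ filt₂ k n) : S * T ∈ filt₂ k (m + n) :=
  bilin_mem_filt₂ (B := LinearMap.mul k _) (B₂ := LinearMap.mul k _) mul_mem_filt
    (fun _ _ _ _ => Algebra.TensorProduct.tmul_mul_tmul _ _ _ _) hS hT

theorem coshuffle_mem_filt₂ {n : ℕ} {X : ForestAlg k} (hX : X ∈ filt k n) :
    coshuffle k X ∈ filt₂ k n := by
  have h : ∀ u : List PTree, coshuffle k (word k u) ∈ filt₂ k (sizeList u) := fun u => by
    induction u with
    | nil => exact mem_filt₂_zero _
    | cons x u ih =>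
      have hx : coshuffle k (word k [x]) ∈ filt₂ k x.size := by
        rw [coshuffle_letter, ← word_nil]
        exact add_mem (word_tmul_word_mem_filt₂ (by simp [sizeList]))
          (word_tmul_word_mem_filt₂ (by simp [sizeList]))
      rw [word_cons, map_mul, sizeList]
      exact mul_mem_filt₂ hx ih
  have : filt k n ≤ (filt₂ k n).comap (coshuffle k).toLinearMap := by
    refine Submodule.span_le.mpr ?_
    rintro _ ⟨u, hu, rfl⟩
    exact filt₂_antitone hu (h u)
  exact this hX

theorem mulAct_mem_filt (Y : ForestAlg k) {n : ℕ} {T : ForestAlg k ⊗[k] ForestAlg k}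
    (hT : T ∈ filt₂ k n) : mulAct Y T ∈ filt k n := by
  have : filt₂ k n ≤ (filt k n).comap (mulAct Y) := by
    refine Submodule.span_le.mpr ?_
    rintro _ ⟨p, hp, rfl⟩
    rw [SetLike.mem_coe, Submodule.mem_comap, mulAct_tmul]
    have h₁ : word k p.1 ∈ filt k (sizeList p.1) := word_mem_filt le_rfl
    have h₂ : word k p.2 ∈ filt k (sizeList p.2) := word_mem_filt le_rfl
    have h := mul_mem_filt h₁ (act_mem_filt h₂ (mem_filt_zero Y))
    rw [add_zero] at h
    exact filt_antitone hp h
  exact this hT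

-- Operators that are the identity up to higher order.

section Unipotent

variable {M : Type*} [AddCommGroup M] [Module k M] {F : ℕ → Submodule k M} {T : M →ₗ[k] M}

theorem mem_of_unipotent (hF : Antitone F) (zero : F 0 = ⊤)
    (hT : ∀ n, ∀ Y ∈ F n, T Y - Y ∈ F (n + 1)) {N : ℕ} {Y : M} (h : T Y ∈ F N) : Y ∈ F N := by
  have : ∀ n ≤ N, Y ∈ F n := by
    intro n
    induction n with
    | zero => simp [zero]
    | succ n ih =>
      intro hn
      rw [← sub_sub_cancel (T Y) Y]
      exact sub_mem (hF hn h) (hT n Y (ih (by omega)))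
  exact this N le_rfl

theorem exists_sub_mem_of_unipotent (zero : F 0 = ⊤)
    (hT : ∀ n, ∀ Y ∈ F n, T Y - Y ∈ F (n + 1)) (C : M) (N : ℕ) : ∃ Y, T Y - C ∈ F N := by
  induction N with
  | zero => exact ⟨0, by simp [zero]⟩
  | succ n ih =>
    obtain ⟨Y, hY⟩ := ih
    -- Newton-type correction: with error `E = T Y - C`, the new error is `E - T E`, one degree
    -- higher.
    refine ⟨Y - (T Y - C), ?_⟩
    rw [map_sub, sub_right_comm, ← neg_sub]
    exact neg_mem (hT n _ hY)

end Unipotent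

end Filtration

-- Passage to series and unipotence of group-like elements.

section Series

variable {k : Type*} [Field k]

/-- The series `a` agrees with `X` on forests with fewer than `n` nodes. -/
def Approx (n : ℕ) (a : Series k) (X : ForestAlg k) : Prop :=
  ∀ w : Forest, w.size < n → X.coeff w = a w

theorem mem_forestsLE {n : ℕ} {w : Forest} : w ∈ forestsLE n ↔ w.size ≤ n := by
  rw [forestsLE, Set.Finite.mem_toFinset]
  rfl

theorem coeff_trunc (n : ℕ) (a : Series k) (w : Forest) :
    (trunc n a).coeff w = if w.size ≤ n then a w else 0 := by
  classical
  simp [trunc, MonoidAlgebra.coeff_sum, Finsupp.finsetSum_apply, Finsupp.single_apply,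
    mem_forestsLE]

/-- The sharp order is `n + 1`; being positive even for `n = 0`, it lets `Approx.sub_one_mem` apply.
-/
theorem approx_trunc (n : ℕ) (a : Series k) : Approx (n + 1) a (trunc n a) := fun w hw => by
  rw [coeff_trunc, if_pos (Nat.lt_succ_iff.mp hw)]

theorem approx_trunc_self (n : ℕ) (a : Series k) : Approx n a (trunc n a) := fun w hw =>
  approx_trunc n a w (hw.trans (Nat.lt_succ_self n))

theorem approx_toSeries (n : ℕ) (X : ForestAlg k) : Approx n (toSeries X) X := fun _ _ => rfl

variable {n : ℕ} {a b c : Series k} {X Y : ForestAlg k}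

theorem Approx.mono {m : ℕ} (h : Approx n a X) (hm : m ≤ n) : Approx m a X :=
  fun w hw => h w (hw.trans_le hm)

theorem Approx.sub_mem (hX : Approx n a X) (hY : Approx n a Y) : X - Y ∈ filt k n :=
  mem_filt_iff.mpr fun w hw => by
    rw [MonoidAlgebra.coeff_sub, Finsupp.sub_apply, hX w hw, hY w hw, sub_self]

theorem Approx.of_sub_mem (hX : Approx n a X) (h : Y - X ∈ filt k n) : Approx n a Y :=
  fun w hw => by
    have := mem_filt_iff.mp h w hw
    rw [MonoidAlgebra.coeff_sub, Finsupp.sub_apply, sub_eq_zero] at this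
    rw [this, hX w hw]

theorem eq_of_approx (h : ∀ n, ∃ X, Approx n a X ∧ Approx n b X) : a = b := funext fun w => by
  obtain ⟨X, ha, hb⟩ := h (w.size + 1)
  rw [← ha w (Nat.lt_succ_self _), ← hb w (Nat.lt_succ_self _)]

theorem counit_eq_coeff (X : ForestAlg k) : counit k X = X.coeff 1 := by
  have : counit k = Finsupp.lapply 1 ∘ₗ (MonoidAlgebra.coeffLinearEquiv k).toLinearMap :=
    linearMap_ext_word fun u => by
      rw [counit_word]
      change _ = Finsupp.single (FreeMonoid.ofList u) (1 : k) 1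
      cases u with
      | nil => simp [sizeList]
      | cons t u =>
        have := t.size_pos
        have hne : sizeList (t :: u) ≠ 0 := by
          simp only [sizeList]
          omega
        rw [if_neg hne]
        exact (Finsupp.single_eq_of_ne' (List.cons_ne_nil t u)).symm
  rw [this]
  rfl

theorem counitS_eq (a : Series k) : counitS a = a 1 := by
  rw [counitS, counit_eq_coeff, coeff_trunc]
  exact if_pos le_rfl

theorem size_eq_zero {w : Forest} (h : w.size = 0) : w = 1 := by
  change List PTree at w
  cases w with
  | nil => rfl
  | cons t u =>
    have := t.size_pos
    have : t.size + sizeList u = 0 := h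
    omega

theorem mem_filt_one_iff : X ∈ filt k 1 ↔ X.coeff 1 = 0 := by
  rw [mem_filt_iff]
  exact ⟨fun h => h 1 Nat.one_pos, fun h w hw => by rw [size_eq_zero (Nat.lt_one_iff.mp hw), h]⟩

/-- Continuity: the coproduct is filtered, so any sufficiently close approximant may replace the
truncation. -/
theorem comulS_eq (h : Approx n a X) {u v : Forest} (huv : u.size + v.size < n) :
    comulS a (u, v) = coeff₂ u v (coshuffle k X) := by
  have := mem_filt₂_iff.mp (coshuffle_mem_filt₂
    (((approx_trunc (u.size + v.size) a).sub_mem (h.mono huv)))) u v (Nat.lt_succ_self _)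
  rw [map_sub, map_sub, sub_eq_zero] at this
  exact this

/-- A series is group-like for the coproduct if all its truncations are so up to higher order. -/
theorem comulS_eq_tensorS (h : ∀ n, ∃ X, Approx n a X ∧ coshuffle k X - X ⊗ₜ X ∈ filt₂ k n) :
    comulS a = tensorS a a := funext fun ⟨u, v⟩ => by
  obtain ⟨X, hX, hmem⟩ := h (u.size + v.size + 1)
  have := mem_filt₂_iff.mp hmem u v (Nat.lt_succ_self _)
  rw [map_sub, sub_eq_zero, coeff₂_tmul, hX u (by omega), hX v (by omega)] at this
  rw [comulS_eq hX (Nat.lt_succ_self _), this]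
  rfl

/-- Converse of `comulS_eq_tensorS`, valid for every approximant. -/
theorem coshuffle_sub_mem (h : comulS a = tensorS a a) (hX : Approx n a X) :
    coshuffle k X - X ⊗ₜ X ∈ filt₂ k n := mem_filt₂_iff.mpr fun u v huv => by
  rw [map_sub, coeff₂_tmul, ← comulS_eq hX huv, h, hX u (by omega), hX v (by omega)]
  exact sub_self _

theorem Approx.sub_one_mem (hX : Approx n a X) (hn : 0 < n) (ha : a 1 = 1) :
    X - 1 ∈ filt k 1 := by
  rw [mem_filt_one_iff, MonoidAlgebra.coeff_sub, Finsupp.sub_apply, hX 1 hn, ha,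
    MonoidAlgebra.one_def]
  simp

/-- A bilinear operation on the forest algebra that is left unital, compatible with the coproduct
and with the filtration. -/
structure IsHopfOperation (B : ForestAlg k →ₗ[k] ForestAlg k →ₗ[k] ForestAlg k)
    (B₂ : ForestAlg k ⊗[k] ForestAlg k →ₗ[k] ForestAlg k ⊗[k] ForestAlg k →ₗ[k]
      ForestAlg k ⊗[k] ForestAlg k) : Prop where
  mem_filt : ∀ {m n : ℕ} {X Y : ForestAlg k}, X ∈ filt k m → Y ∈ filt k n → B X Y ∈ filt k (m + n)
  tmul : ∀ X X' Y Y', B₂ (X ⊗ₜ X') (Y ⊗ₜ Y') = B X Y ⊗ₜ B X' Y'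
  one : ∀ Y, B 1 Y = Y
  coshuffle : ∀ X Y, coshuffle k (B X Y) = B₂ (coshuffle k X) (coshuffle k Y)

theorem isHopfOperation_mul :
    IsHopfOperation (LinearMap.mul k (ForestAlg k)) (LinearMap.mul k _) where
  mem_filt := mul_mem_filt
  tmul _ _ _ _ := Algebra.TensorProduct.tmul_mul_tmul _ _ _ _
  one := one_mul
  coshuffle := map_mul (coshuffle k)

theorem isHopfOperation_act : IsHopfOperation (act k) act₂ where
  mem_filt := act_mem_filt
  tmul := act₂_tmul
  one _ := by rw [act_one, LinearMap.id_apply]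
  coshuffle := coshuffle_act

/-- The continuous extension of a bilinear operation to series. -/
noncomputable def complete (B : ForestAlg k →ₗ[k] ForestAlg k →ₗ[k] ForestAlg k)
    (a b : Series k) : Series k := fun w => (B (trunc w.size a) (trunc w.size b)).coeff w

theorem mulS_eq_complete : mulS a b = complete (LinearMap.mul k _) a b := rfl

theorem rhdS_eq_complete : rhdS a b = complete (act k) a b :=
  funext fun w => by rw [rhdS, rhd_eq_act]; rfl

namespace IsHopfOperation

variable {B : ForestAlg k →ₗ[k] ForestAlg k →ₗ[k] ForestAlg k}
  {B₂ : ForestAlg k ⊗[k] ForestAlg k →ₗ[k] ForestAlg k ⊗[k] ForestAlg k →ₗ[k]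
    ForestAlg k ⊗[k] ForestAlg k}

theorem mem_filt₂ (hB : IsHopfOperation B B₂) {m n : ℕ} {S T : ForestAlg k ⊗[k] ForestAlg k}
    (hS : S ∈ filt₂ k m) (hT : T ∈ filt₂ k n) : B₂ S T ∈ filt₂ k (m + n) :=
  bilin_mem_filt₂ hB.mem_filt hB.tmul hS hT

theorem sub_mem_filt (hB : IsHopfOperation B B₂) {X X' Y Y' : ForestAlg k}
    (hX : X - X' ∈ filt k n) (hY : Y - Y' ∈ filt k n) : B X Y - B X' Y' ∈ filt k n := by
  have h₁ := hB.mem_filt hX (mem_filt_zero Y)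
  have h₂ := hB.mem_filt (mem_filt_zero X') hY
  rw [add_zero, map_sub, LinearMap.sub_apply] at h₁
  rw [zero_add, map_sub] at h₂
  rw [← sub_add_sub_cancel _ (B X' Y)]
  exact add_mem h₁ h₂

theorem approx (hB : IsHopfOperation B B₂) (hX : Approx n a X) (hY : Approx n b Y) :
    Approx n (complete B a b) (B X Y) := fun w hw => by
  have := mem_filt_iff.mp (hB.sub_mem_filt ((hX.mono hw).sub_mem (approx_trunc w.size a))
    ((hY.mono hw).sub_mem (approx_trunc w.size b))) w (Nat.lt_succ_self _)
  rw [MonoidAlgebra.coeff_sub, Finsupp.sub_apply, sub_eq_zero] at this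
  exact this

/-- The difference is `B (X - 1) Y`. This is the unipotence hypothesis for `B X`. -/
theorem sub_mem_succ (hB : IsHopfOperation B B₂) (hX : X - 1 ∈ filt k 1) (m : ℕ)
    (Y : ForestAlg k) (hY : Y ∈ filt k m) : B X Y - Y ∈ filt k (m + 1) := by
  have := hB.mem_filt hX hY
  rwa [map_sub, LinearMap.sub_apply, hB.one, add_comm] at this

theorem sub_mem_succ₂ (hB : IsHopfOperation B B₂) (hX : X - 1 ∈ filt k 1) (m : ℕ)
    (T : ForestAlg k ⊗[k] ForestAlg k) (hT : T ∈ filt₂ k m) :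
    B₂ (X ⊗ₜ X) T - T ∈ filt₂ k (m + 1) := by
  have h : X ⊗ₜ X - 1 ⊗ₜ 1 ∈ filt₂ k 1 := by
    have h₁ := tmul_mem_filt₂ hX (mem_filt_zero X)
    have h₂ := tmul_mem_filt₂ (mem_filt_zero 1) hX
    rw [add_zero, TensorProduct.sub_tmul] at h₁
    rw [zero_add, TensorProduct.tmul_sub] at h₂
    rw [← sub_add_sub_cancel _ (1 ⊗ₜ X)]
    exact add_mem h₁ h₂
  have hone : ∀ T, B₂ (1 ⊗ₜ 1) T = T := fun T => by
    induction T with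
    | zero => simp
    | add S T hS hT => rw [map_add, hS, hT]
    | tmul A C => rw [hB.tmul, hB.one, hB.one]
  have := hB.mem_filt₂ h hT
  rwa [map_sub, LinearMap.sub_apply, hone, add_comm] at this

theorem complete_apply_one (hB : IsHopfOperation B B₂) (ha : a 1 = 1) :
    complete B a b 1 = b 1 := by
  have h := (approx_trunc 0 a).sub_one_mem Nat.one_pos ha
  have := hB.sub_mem_succ h 0 (trunc 0 b) (mem_filt_zero _)
  rw [zero_add, mem_filt_one_iff, MonoidAlgebra.coeff_sub, Finsupp.sub_apply, sub_eq_zero,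
    hB.approx (approx_trunc 0 a) (approx_trunc 0 b) 1 Nat.one_pos,
    approx_trunc 0 b 1 Nat.one_pos] at this
  exact this

/-- Modulo order `n`, `Δ B(X, Y) = B₂(ΔX, ΔY)` may be replaced by `B₂(X ⊗ X, Y ⊗ Y) = B(X, Y) ⊗ B(X,
Y)`. -/
theorem groupLike (hB : IsHopfOperation B B₂) (ha : comulS a = tensorS a a)
    (hb : comulS b = tensorS b b) :
    comulS (complete B a b) = tensorS (complete B a b) (complete B a b) :=
  comulS_eq_tensorS fun n => by
    refine ⟨_, hB.approx (approx_trunc_self n a) (approx_trunc_self n b), ?_⟩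
    have h₁ := hB.mem_filt₂ (coshuffle_sub_mem ha (approx_trunc_self n a))
      (mem_filt₂_zero (LieButcher.coshuffle k (trunc n b)))
    have h₂ := hB.mem_filt₂ (mem_filt₂_zero (trunc n a ⊗ₜ trunc n a))
      (coshuffle_sub_mem hb (approx_trunc_self n b))
    rw [add_zero, map_sub, LinearMap.sub_apply] at h₁
    rw [zero_add, map_sub, hB.tmul] at h₂
    rw [hB.coshuffle, ← sub_add_sub_cancel]
    exact add_mem h₁ h₂

/-- The operator `B₂ (X ⊗ X)` sends `ΔY - Y ⊗ Y` to the defect of `B(X, Y)` up to high order, hence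
to something negligible; being unipotent, it can be cancelled. -/
theorem groupLike_right (hB : IsHopfOperation B B₂) (ha : comulS a = tensorS a a) (ha₁ : a 1 = 1)
    (hc : comulS (complete B a b) = tensorS (complete B a b) (complete B a b)) :
    comulS b = tensorS b b :=
  comulS_eq_tensorS fun n => by
    have hX := approx_trunc n a
    have hY := approx_trunc n b
    refine ⟨_, approx_trunc_self n b, filt₂_antitone (Nat.le_succ n) ?_⟩
    refine mem_of_unipotent filt₂_antitone filt₂_zero
      (hB.sub_mem_succ₂ (hX.sub_one_mem n.succ_pos ha₁)) ?_
    have h₁ := hB.mem_filt₂ (coshuffle_sub_mem ha hX)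
      (mem_filt₂_zero (LieButcher.coshuffle k (trunc n b)))
    have h₂ := coshuffle_sub_mem hc (hB.approx hX hY)
    rw [add_zero, map_sub, LinearMap.sub_apply] at h₁
    rw [hB.coshuffle] at h₂
    rw [map_sub, hB.tmul, ← sub_sub_sub_cancel_left _ _ (B₂ (LieButcher.coshuffle k (trunc n a))
      (LieButcher.coshuffle k (trunc n b)))]
    exact sub_mem h₂ h₁

theorem injective (hB : IsHopfOperation B B₂) (ha : a 1 = 1) :
    Function.Injective (complete B a) := fun b c h => eq_of_approx fun n => by
  have hX := approx_trunc n a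
  have hb := approx_trunc n b
  have hc := approx_trunc n c
  have hsub : trunc n b - trunc n c ∈ filt k (n + 1) := by
    refine mem_of_unipotent filt_antitone filt_zero
      (hB.sub_mem_succ (hX.sub_one_mem n.succ_pos ha)) ?_
    have h₁ := hB.approx hX hb
    rw [h] at h₁
    rw [map_sub]
    exact h₁.sub_mem (hB.approx hX hc)
  exact ⟨_, hb.mono (Nat.le_succ n), (hc.of_sub_mem hsub).mono (Nat.le_succ n)⟩

theorem surjective (hB : IsHopfOperation B B₂) (ha : a 1 = 1) :
    Function.Surjective (complete B a) := fun c => by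
  have hone (n : ℕ) := (approx_trunc n a).sub_one_mem n.succ_pos ha
  choose Y hY using fun n => exists_sub_mem_of_unipotent filt_zero
    (hB.sub_mem_succ (hone n)) (trunc n c) (n + 1)
  -- Each coefficient is read from the approximate solution of the least order that determines it.
  let b : Series k := fun w => (Y w.size).coeff w
  have hc (n : ℕ) : Approx (n + 1) c (B (trunc n a) (Y n)) :=
    (approx_trunc n c).of_sub_mem (hY n)
  have hb (n : ℕ) : Approx (n + 1) b (Y n) := fun w hw => by
    -- Both solve the same equation up to order `w.size + 1`, so unipotence forces them to agree to
    -- that order.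
    have hsub : Y n - Y w.size ∈ filt k (w.size + 1) := by
      refine mem_of_unipotent filt_antitone filt_zero (hB.sub_mem_succ (hone n)) ?_
      have h₁ : B (trunc n a) (Y w.size) - B (trunc w.size a) (Y w.size) ∈ filt k (w.size + 1) :=
        hB.sub_mem_filt (((approx_trunc n a).mono hw).sub_mem (approx_trunc w.size a))
          (by rw [sub_self]; exact zero_mem _)
      rw [map_sub]
      exact ((hc n).mono hw).sub_mem ((hc w.size).of_sub_mem h₁)
    have := mem_filt_iff.mp hsub w (Nat.lt_succ_self _)
    rwa [MonoidAlgebra.coeff_sub, Finsupp.sub_apply, sub_eq_zero] at this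
  refine ⟨b, eq_of_approx fun n => ⟨_, (hB.approx (approx_trunc n a) (hb n)).mono (Nat.le_succ n),
    (hc n).mono (Nat.le_succ n)⟩⟩

end IsHopfOperation

theorem approx_mulS (hX : Approx n a X) (hY : Approx n b Y) : Approx n (mulS a b) (X * Y) :=
  isHopfOperation_mul.approx hX hY

theorem approx_rhdS (hX : Approx n a X) (hY : Approx n b Y) : Approx n (rhdS a b) (act k X Y) := by
  rw [rhdS_eq_complete]
  exact isHopfOperation_act.approx hX hY

theorem mulS_assoc (a b c : Series k) : mulS (mulS a b) c = mulS a (mulS b c) :=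
  eq_of_approx fun n => by
    have ha := approx_trunc_self n a
    have hb := approx_trunc_self n b
    have hc := approx_trunc_self n c
    refine ⟨_, approx_mulS (approx_mulS ha hb) hc, ?_⟩
    rw [mul_assoc]
    exact approx_mulS ha (approx_mulS hb hc)

theorem mulS_oneS (a : Series k) : mulS a oneS = a :=
  eq_of_approx fun n => ⟨_, approx_mulS (approx_trunc_self n a) (approx_toSeries n 1), by
    rw [mul_one]
    exact approx_trunc_self n a⟩

theorem oneS_apply_one : (oneS : Series k) 1 = 1 := by
  simp [oneS, toSeries, MonoidAlgebra.one_def]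

theorem comulS_oneS : comulS (oneS : Series k) = tensorS oneS oneS :=
  comulS_eq_tensorS fun n => ⟨1, approx_toSeries n 1, by
    rw [coshuffle_one, sub_self]
    exact zero_mem _⟩

theorem rhdS_mulS (ha : comulS a = tensorS a a) (b c : Series k) :
    rhdS a (mulS b c) = mulS (rhdS a b) (rhdS a c) := eq_of_approx fun n => by
  have hX := approx_trunc_self n a
  have hb := approx_trunc_self n b
  have hc := approx_trunc_self n c
  refine ⟨_, approx_rhdS hX (approx_mulS hb hc),
    (approx_mulS (approx_rhdS hX hb) (approx_rhdS hX hc)).of_sub_mem ?_⟩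
  have h := isHopfOperation_act.mem_filt₂ (coshuffle_sub_mem ha hX)
    (mem_filt₂_zero (trunc n b ⊗ₜ trunc n c))
  have hmul : filt₂ k (n + 0) ≤ (filt k n).comap (LinearMap.mul' k _) := by
    refine Submodule.span_le.mpr ?_
    rintro _ ⟨p, hp, rfl⟩
    rw [SetLike.mem_coe, Submodule.mem_comap, LinearMap.mul'_apply, ← word_append]
    exact word_mem_filt (hp.trans (sizeList_append _ _).ge)
  have := hmul h
  rwa [Submodule.mem_comap, map_sub, LinearMap.sub_apply, map_sub, ← act_mul, act₂_tmul,
    LinearMap.mul'_apply, LinearMap.mul'_apply] at this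

/-- A truncation `X` is not itself group-like; replacing `X ⊗ X` by `ΔX` costs only high order and
makes the exact identity `act_act` applicable. -/
theorem approx_mulAct (ha : comulS a = tensorS a a) (hX : Approx n a X) (hY : Approx n b Y) :
    Approx n (mulS a (rhdS a b)) (mulAct Y (coshuffle k X)) := by
  refine (approx_mulS hX (approx_rhdS hX hY)).of_sub_mem ?_
  rw [← mulAct_tmul, ← map_sub]
  exact mulAct_mem_filt Y (coshuffle_sub_mem ha hX)

theorem rhdS_rhdS (ha : comulS a = tensorS a a) (b c : Series k) :
    rhdS (mulS a (rhdS a b)) c = rhdS a (rhdS b c) := eq_of_approx fun n => by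
  have hX := approx_trunc_self n a
  have hY := approx_trunc_self n b
  have hZ := approx_trunc_self n c
  refine ⟨_, approx_rhdS (approx_mulAct ha hX hY) hZ, ?_⟩
  rw [← act_act]
  exact approx_rhdS hX (approx_rhdS hY hZ)

/-- On a group-like series the sub-adjacent product is `a * b = a (a ▷ b)`. -/
theorem starS_eq (ha : comulS a = tensorS a a) (b : Series k) :
    starS a b = mulS a (rhdS a b) := funext fun w => by
  have hsum : trunc w.size a = ∑ u ∈ forestsLE w.size, a u • ofForest u := by
    simp [trunc, MonoidAlgebra.smul_single]
  have hY := approx_trunc w.size b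
  have hterm (u v : Forest) : mulS (toSeries (ofForest u)) (rhdS (toSeries (ofForest v)) b) w =
      (ofForest u * act k (ofForest v) (trunc w.size b)).coeff w :=
    (approx_mulS (approx_toSeries _ _) (approx_rhdS (approx_toSeries _ _) hY) w
      (Nat.lt_succ_self _)).symm
  have hX := approx_trunc w.size a
  -- Since `a` is group-like, the weight of the pair `(u, v)` becomes `a u * a v`, and the double
  -- sum factors.
  rw [← approx_mulS hX (approx_rhdS hX hY) w (Nat.lt_succ_self _), starS, ha]
  simp only [hterm, tensorS]
  rw [hsum, map_sum, LinearMap.sum_apply, Finset.sum_mul_sum, ← Finset.sum_product',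
    MonoidAlgebra.coeff_sum, Finsupp.finsetSum_apply]
  refine Finset.sum_congr rfl fun p _ => ?_
  rw [map_smul, LinearMap.smul_apply, smul_mul_smul_comm, MonoidAlgebra.coeff_smul,
    Finsupp.smul_apply, smul_eq_mul]

end Series

-- The post-group of group-like series.

section PostGroup

variable (k : Type*) [Field k]

variable {k} in
theorem GroupLike.apply_one (a : GroupLike k) : a.1 1 = 1 := (counitS_eq a.1).symm.trans a.2.2

/-- The product of group-like series. -/
noncomputable instance : Mul (GroupLike k) :=
  ⟨fun a b => ⟨mulS a.1 b.1, isHopfOperation_mul.groupLike a.2.1 b.2.1, by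
    rw [counitS_eq, mulS_eq_complete, isHopfOperation_mul.complete_apply_one a.apply_one,
      b.apply_one]⟩⟩

noncomputable instance : One (GroupLike k) :=
  ⟨⟨oneS, comulS_oneS, by rw [counitS_eq, oneS_apply_one]⟩⟩

variable {k} in
-- For concatenation with `c = 1` this gives inverses; for `▷` it gives surjectivity of `a ▷ ·` on
-- group-likes.
theorem IsHopfOperation.exists_groupLike {B : ForestAlg k →ₗ[k] ForestAlg k →ₗ[k] ForestAlg k}
    {B₂ : ForestAlg k ⊗[k] ForestAlg k →ₗ[k] ForestAlg k ⊗[k] ForestAlg k →ₗ[k]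
      ForestAlg k ⊗[k] ForestAlg k} (hB : IsHopfOperation B B₂) (a c : GroupLike k) :
    ∃ b : GroupLike k, complete B a.1 b.1 = c.1 := by
  obtain ⟨b, hb⟩ := hB.surjective a.apply_one c.1
  refine ⟨⟨b, hB.groupLike_right a.2.1 a.apply_one (hb ▸ c.2.1), ?_⟩, hb⟩
  rw [counitS_eq, ← hB.complete_apply_one (b := b) a.apply_one, hb, c.apply_one]

/-- Inverses of group-like series. -/
noncomputable instance : Inv (GroupLike k) :=
  ⟨fun a => (isHopfOperation_mul.exists_groupLike a 1).choose⟩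

noncomputable instance : Group (GroupLike k) :=
  Group.ofRightAxioms (fun a b c => Subtype.ext (mulS_assoc a.1 b.1 c.1))
    (fun a => Subtype.ext (mulS_oneS a.1))
    (fun a => Subtype.ext (isHopfOperation_mul.exists_groupLike a 1).choose_spec)

/-- The post-group of group-like Lie-Butcher series. -/
noncomputable def groupLikePostGroup : PostGroup (GroupLike k) where
  toGroup := inferInstance
  rhd a b := ⟨rhdS a.1 b.1, by
    rw [rhdS_eq_complete]
    exact isHopfOperation_act.groupLike a.2.1 b.2.1, by
    rw [counitS_eq, rhdS_eq_complete, isHopfOperation_act.complete_apply_one a.apply_one,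
      b.apply_one]⟩
  rhd_bijective a := by
    constructor
    · intro b c h
      have h' : rhdS a.1 b.1 = rhdS a.1 c.1 := congrArg Subtype.val h
      rw [rhdS_eq_complete, rhdS_eq_complete] at h'
      exact Subtype.ext (isHopfOperation_act.injective a.apply_one h')
    · intro c
      obtain ⟨b, hb⟩ := isHopfOperation_act.exists_groupLike a c
      exact ⟨b, Subtype.ext (rhdS_eq_complete.trans hb)⟩
  rhd_mul a b c := Subtype.ext (rhdS_mulS a.2.1 b.1 c.1)
  rhd_rhd a b c := Subtype.ext (rhdS_rhdS a.2.1 b.1 c.1)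

end PostGroup

end LieButcher

theorem mainTheorem11 (k : Type*) [Field k] [CharZero k] :
    ∃ P : PostGroup (LieButcher.GroupLike k),
      -- `P` is the post-group of group-like elements of the complete post-Hopf algebra
      (∀ a b, (P.mul a b).1 = LieButcher.mulS a.1 b.1) ∧
      P.one.1 = LieButcher.oneS ∧
      (∀ a b, (P.rhd a b).1 = LieButcher.rhdS a.1 b.1) ∧
      -- `L` is the Lie-Butcher group: the group of group-like elements of the sub-adjacent
      -- complete Hopf algebra
      ∃ L : Group (LieButcher.GroupLike k),
        (∀ a b, (L.mul a b).1 = LieButcher.starS a.1 b.1) ∧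
        L.one.1 = LieButcher.oneS ∧
        P.subAdjacent = L :=
  ⟨LieButcher.groupLikePostGroup k, fun _ _ => rfl, rfl, fun _ _ => rfl,
    -- The Lie–Butcher group is given as the sub-adjacent group itself; the content is that its
    -- product is `starS`, which is `starS_eq`.
    (LieButcher.groupLikePostGroup k).subAdjacent,
    fun a b => (LieButcher.starS_eq a.2.1 b.1).symm, rfl, rfl⟩
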